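/- Let $G$ be a finite connected simple graph with $d$ vertices and $e$ edges. Let $c_4(G)$ be the number of $4$-cycles of $G$ (subgraphs of $G$ that are cycles of length $4$, not necessarily induced), and let $k_4(G)$ be the number of subgraphs of $G$ that are complete graphs $K_4$ on $4$ vertices. (i) If $G$ is bipartite, then $$c_4(G) \le \frac{e(e-d+1)}{4},$$ with equality if and only if $G$ is a tree or a complete bipartite graph. (ii) If $G$ has at least one odd cycle and contains no $K_4$, then $$c_4(G) \le \frac{e(e-d)}{4},$$ with equality if and only if $G$ has exactly one cycle and the length of that cycle is odd. (iii) If $G$ contains at least one $K_4$, then $$c_4(G) < \frac{e(e-d)}{4} + \frac{3}{2}\,k_4(G).$$ -/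

import Mathlib

/-- The subgraph `H` of `G` is a cycle of length `n`: it consists of the vertices and edges of some
closed walk of length `n` that has no repeated edge and, apart from its endpoints, no repeated
vertex.  Walks that differ in their starting point or direction give the same `H`. -/
def SimpleGraph.Subgraph.IsCycleOfLength {V : Type*} {G : SimpleGraph V} (H : G.Subgraph)
    (n : ℕ) : Prop :=
  ∃ (v : V) (p : G.Walk v v), p.IsCycle ∧ p.length = n ∧ p.toSubgraph = H

/-- The set of all cycles of `G`, as subgraphs of `G`. -/
def SimpleGraph.cycles {V : Type*} (G : SimpleGraph V) : Set G.Subgraph :=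
  {H | ∃ n : ℕ, H.IsCycleOfLength n}

/-- `G` has at least one cycle of odd length. -/
def SimpleGraph.HasOddCycle {V : Type*} (G : SimpleGraph V) : Prop :=
  ∃ (H : G.Subgraph) (n : ℕ), Odd n ∧ H.IsCycleOfLength n

/-- `G` has exactly one cycle, and the length of that cycle is odd. -/
def SimpleGraph.HasUniqueCycleOdd {V : Type*} (G : SimpleGraph V) : Prop :=
  ∃ C : G.Subgraph, G.cycles = {C} ∧ ∃ n : ℕ, Odd n ∧ C.IsCycleOfLength n

/-- The number of 4-cycles of `G`, that is, of subgraphs of `G` that are cycles of length 4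
(not necessarily induced). -/
noncomputable def SimpleGraph.numFourCycles {V : Type*} (G : SimpleGraph V) : ℕ :=
  {H : G.Subgraph | H.IsCycleOfLength 4}.ncard

/-- `G` is a complete bipartite graph `K_{ℓ,m}` with `ℓ, m ≥ 1`. -/
def SimpleGraph.IsCompleteBipartiteGraph {V : Type*} (G : SimpleGraph V) : Prop :=
  ∃ l m : ℕ, 1 ≤ l ∧ 1 ≤ m ∧ Nonempty (G ≃g completeBipartiteGraph (Fin l) (Fin m))

/-! Fix an edge `uv` and delete every edge opposite to it in a 4-cycle. A deleted edge is bypassed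
by the other three sides of its square, which survive. So the remaining graph is connected, and
since three is odd, a 2-colouring of it also 2-colours `G`. Hence at least `d - 1` edges remain, and
at least `d` if `G` is not bipartite.

An edge `xy` is opposite to `uv` in one square, or in two exactly when `u, v, x, y` span a `K_4`.
Summing over all edges `uv` (`numFourCycles_identity`) counts each 4-cycle four times with a
correction for the `K_4`'s, and gives the three bounds in weak form.

If a bound is attained, every deletion leaves exactly `d - 1` (resp. `d`) edges. The remainder then
contains no square: it is a tree, or a connected graph with one independent cycle that is not
bipartite. If moreover `G` has more edges than the remainder, every edge lies in a square. Together
these two facts force complete bipartiteness in the bipartite case (`adj_of_path_three`) and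
contradict non-bipartiteness otherwise (`colorable_two_of_not_isSquare_deleteOpposite`). When `G`
contains a `K_4`, the remainder visibly contains a square, so the inequality is strict. -/

namespace SimpleGraph

/-! ### Deleting the edges opposite to a given edge -/

section

variable {V : Type*}

/-- The vertices `a, b, c, d` are, in this order, the vertices of a 4-cycle of `G`. -/
def IsSquare (G : SimpleGraph V) (a b c d : V) : Prop :=
  G.Adj a b ∧ G.Adj b c ∧ G.Adj c d ∧ G.Adj d a ∧ a ≠ c ∧ b ≠ d

/-- The graph `G` without the edges that are opposite to `uv` in some 4-cycle. -/
def deleteOpposite (G : SimpleGraph V) (u v : V) : SimpleGraph V where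
  Adj x y := G.Adj x y ∧ ¬ G.IsSquare u v x y ∧ ¬ G.IsSquare u v y x
  symm := ⟨fun _ _ h => ⟨h.1.symm, h.2.2, h.2.1⟩⟩
  loopless := ⟨fun _ h => h.1.ne rfl⟩

variable {G H : SimpleGraph V} {a b c d u v w x y : V}

theorem deleteOpposite_adj :
    (G.deleteOpposite u v).Adj x y ↔
      G.Adj x y ∧ ¬ G.IsSquare u v x y ∧ ¬ G.IsSquare u v y x := Iff.rfl

/-- The four vertices of a square are distinct, so an edge meeting `u` or `v` is never opposite to
`uv`. -/
theorem Adj.deleteOpposite_left (h : G.Adj u x) : (G.deleteOpposite u v).Adj u x :=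
  ⟨h, fun s => s.2.2.2.2.1 rfl, fun s => s.2.2.2.1.ne rfl⟩

theorem Adj.deleteOpposite_right (h : G.Adj v x) : (G.deleteOpposite u v).Adj v x :=
  ⟨h, fun s => s.2.1.ne rfl, fun s => s.2.2.2.2.2 rfl⟩

theorem colorable_two_iff : G.Colorable 2 ↔ ∃ f : V → Bool, ∀ x y, G.Adj x y → f x ≠ f y := by
  constructor
  · intro h
    have c : G.Coloring Bool := h.toColoring (by simp)
    exact ⟨c, fun x y hxy => c.valid hxy⟩
  · rintro ⟨f, hf⟩
    have c : G.Coloring Bool := Coloring.mk f (fun {x y} h => hf x y h)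
    simpa using c.colorable

/-- If the endpoints of every edge of `G` outside `H` are joined by a walk of length 3 in `H`,
then `H` is connected when `G` is. -/
theorem Connected.of_detour (hG : G.Connected)
    (h : ∀ x y, G.Adj x y → H.Adj x y ∨ ∃ p q, H.Adj x p ∧ H.Adj p q ∧ H.Adj q y) :
    H.Connected := by
  have := hG.nonempty
  refine ⟨fun x y => ?_⟩
  obtain ⟨p⟩ := hG.preconnected x y
  induction p with
  | nil => rfl
  | cons hadj _ ih =>
    refine Reachable.trans ?_ ih
    rcases h _ _ hadj with h | ⟨p, q, h1, h2, h3⟩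
    · exact h.reachable
    · exact h1.reachable.trans (h2.reachable.trans h3.reachable)

/-- In a 2-colouring the ends of a walk of odd length 3 have different colours. -/
theorem Colorable.of_detour (hH : H.Colorable 2)
    (h : ∀ x y, G.Adj x y → H.Adj x y ∨ ∃ p q, H.Adj x p ∧ H.Adj p q ∧ H.Adj q y) :
    G.Colorable 2 := by
  rw [colorable_two_iff] at hH ⊢
  obtain ⟨f, hf⟩ := hH
  refine ⟨f, fun x y hxy => ?_⟩
  rcases h x y hxy with h | ⟨p, q, h1, h2, h3⟩
  · exact hf _ _ h
  · have h1 := hf _ _ h1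
    have h2 := hf _ _ h2
    have h3 := hf _ _ h3
    revert h1 h2 h3
    cases f x <;> cases f y <;> cases f p <;> cases f q <;> simp

theorem deleteOpposite_detour (huv : G.Adj u v) (x y : V) (hxy : G.Adj x y) :
    (G.deleteOpposite u v).Adj x y ∨ ∃ p q, (G.deleteOpposite u v).Adj x p ∧
      (G.deleteOpposite u v).Adj p q ∧ (G.deleteOpposite u v).Adj q y := by
  by_cases h1 : G.IsSquare u v x y
  · exact Or.inr ⟨v, u, (h1.2.1.deleteOpposite_right).symm, huv.deleteOpposite_left.symm,
      h1.2.2.2.1.symm.deleteOpposite_left⟩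
  by_cases h2 : G.IsSquare u v y x
  · exact Or.inr ⟨u, v, (h2.2.2.2.1.symm.deleteOpposite_left).symm, huv.deleteOpposite_left,
      h2.2.1.deleteOpposite_right⟩
  exact Or.inl ⟨hxy, h1, h2⟩

theorem Connected.deleteOpposite (hG : G.Connected) (huv : G.Adj u v) :
    (G.deleteOpposite u v).Connected :=
  hG.of_detour (deleteOpposite_detour huv)

theorem colorable_two_of_deleteOpposite (huv : G.Adj u v)
    (h : (G.deleteOpposite u v).Colorable 2) : G.Colorable 2 :=
  h.of_detour (deleteOpposite_detour huv)

theorem card_edgeSet_deleteEdge [Finite V] (h : G.Adj a b) :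
    Nat.card (G.deleteEdges {s(a, b)}).edgeSet + 1 = Nat.card G.edgeSet := by
  rw [edgeSet_deleteEdges, Nat.card_coe_set_eq, Nat.card_coe_set_eq]
  exact Set.ncard_sdiff_singleton_add_one h

/-- After deleting an edge of a square, every edge of `G` can be replaced by a walk of length at
most 3. -/
theorem IsSquare.detour (h : G.IsSquare a b c d) (x y : V) (hxy : G.Adj x y) :
    (G.deleteEdges {s(a, b)}).Adj x y ∨ ∃ p q, (G.deleteEdges {s(a, b)}).Adj x p ∧
      (G.deleteEdges {s(a, b)}).Adj p q ∧ (G.deleteEdges {s(a, b)}).Adj q y := by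
  obtain ⟨h1, h2, h3, h4, h5, h6⟩ := h
  have n1 := h1.ne
  have n2 := h2.ne
  have n3 := h3.ne
  have n4 := h4.ne
  have e1 : (G.deleteEdges {s(a, b)}).Adj b c := by
    simp [deleteEdges_adj]; grind
  have e2 : (G.deleteEdges {s(a, b)}).Adj c d := by
    simp [deleteEdges_adj]; grind
  have e3 : (G.deleteEdges {s(a, b)}).Adj d a := by
    simp [deleteEdges_adj]; grind
  by_cases hx : s(x, y) = s(a, b)
  · right
    rcases Sym2.eq_iff.1 hx with ⟨rfl, rfl⟩ | ⟨rfl, rfl⟩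
    · exact ⟨d, c, e3.symm, e2.symm, e1.symm⟩
    · exact ⟨c, d, e1, e2, e3⟩
  · left
    simpa [deleteEdges_adj, hxy] using hx

/-- A connected graph with as many edges as vertices that contains a square is bipartite. -/
theorem IsSquare.colorable_two [Finite V] (h : G.IsSquare a b c d) (hG : G.Connected)
    (hcard : Nat.card G.edgeSet = Nat.card V) : G.Colorable 2 := by
  refine Colorable.of_detour (IsTree.colorable_two ?_) h.detour
  rw [isTree_iff_connected_and_card]
  exact ⟨hG.of_detour h.detour, by rw [card_edgeSet_deleteEdge h.1, hcard]⟩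

theorem IsTree.not_isSquare [Finite V] (hG : G.IsTree) : ¬ G.IsSquare a b c d := by
  intro h
  have h1 := (hG.connected.of_detour h.detour).card_vert_le_card_edgeSet_add_one
  have h2 := (isTree_iff_connected_and_card.1 hG).2
  rw [card_edgeSet_deleteEdge h.1] at h1
  omega

/-- If fewer edges remain than there were, then `uv` lies in a square. -/
theorem exists_isSquare_of_card_lt
    (h : Nat.card (G.deleteOpposite u v).edgeSet < Nat.card G.edgeSet) :
    ∃ x y, G.IsSquare u v x y := by
  by_contra! hno
  refine h.ne ?_
  congr 3
  ext x y
  simp [deleteOpposite_adj, hno]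

/-- In a triangle-free graph all of whose edges lie in squares and in which every edge `pq` meets
every square in an edge opposite to `pq`, the endpoints of a path of length 3 are adjacent. -/
theorem adj_of_path_three
    (htri : ∀ x y z, G.Adj x y → G.Adj y z → ¬ G.Adj x z)
    (hsq : ∀ u v, G.Adj u v → ∃ x y, G.IsSquare u v x y)
    (hno : ∀ u v, G.Adj u v → ∀ a b c d, ¬ (G.deleteOpposite u v).IsSquare a b c d)
    (hvu : G.Adj v u) (hux : G.Adj u x) (hxw : G.Adj x w) (hvx : v ≠ x) :
    G.Adj v w := by
  by_contra hvw
  obtain ⟨p, q, h1, h2, h3, h4, h5, h6⟩ := hsq u x hux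
  -- Otherwise the square `u x p q` survives the deletion for `uv`: the sides at `u` always do, and
  -- the other two could only be opposite to `uv` through a triangle or the edge `pv`.
  have hpv : G.Adj p v := by
    by_contra hpv
    refine hno u v hvu.symm u x p q ⟨h1.deleteOpposite_left, ⟨h2, ?_, ?_⟩, ⟨h3, ?_, ?_⟩,
      h4.symm.deleteOpposite_left.symm, h5, h6⟩
    · exact fun s => htri _ _ _ hvu h1 s.2.1
    · exact fun s => hpv s.2.1.symm
    · exact fun s => hpv s.2.1.symm
    · exact fun s => htri _ _ _ h2 s.2.2.2.1 h1.symm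
  -- Now `u x p v` is a square. Since `vw` is not an edge, it survives the deletion for `xw`.
  refine hno x w hxw u x p v ⟨h1.symm.deleteOpposite_left.symm, h2.deleteOpposite_left,
    ⟨hpv, ?_, ?_⟩, ⟨hvu, ?_, ?_⟩, h5, hvx.symm⟩
  · exact fun s => htri _ _ _ hux.symm hvu.symm s.2.2.2.1.symm
  · exact fun s => hvw s.2.1.symm
  · exact fun s => hvw s.2.1.symm
  · exact fun s => htri _ _ _ hux.symm hvu.symm s.2.2.2.1.symm

/-- If the endpoints of every path of length 3 are adjacent and there are no triangles, then the
two neighbourhoods of the endpoints of an edge make up the graph. -/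
theorem adj_or_adj_of_path_three (hG : G.Connected)
    (hp : ∀ v u x w, G.Adj v u → G.Adj u x → G.Adj x w → v ≠ x → G.Adj v w)
    (huv : G.Adj u v) (w : V) : G.Adj u w ∨ G.Adj v w := by
  obtain ⟨p⟩ := hG.preconnected w u
  induction p with
  | nil => exact Or.inr huv.symm
  | @cons a b c hab _ ih =>
    rcases ih huv with h | h
    · by_cases h1 : v = b
      · exact Or.inr (h1 ▸ hab.symm)
      exact Or.inr (hp _ _ _ _ huv.symm h hab.symm h1)
    · by_cases h1 : c = b
      · exact Or.inl (h1 ▸ hab.symm)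
      exact Or.inl (hp _ _ _ _ huv h hab.symm h1)

end

/-! ### 4-cycles as subgraphs and as ordered quadruples -/

section

variable {V : Type*} {G : SimpleGraph V} {a b c d u v x y : V}

namespace IsSquare

/-- The closed walk around a square. -/
def walk (h : G.IsSquare a b c d) : G.Walk a a :=
  .cons h.1 (.cons h.2.1 (.cons h.2.2.1 (.cons h.2.2.2.1 .nil)))

theorem edges_walk (h : G.IsSquare a b c d) :
    h.walk.edges = [s(a, b), s(b, c), s(c, d), s(d, a)] := rfl

theorem rotate (h : G.IsSquare a b c d) : G.IsSquare b c d a :=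
  ⟨h.2.1, h.2.2.1, h.2.2.2.1, h.1, h.2.2.2.2.2, h.2.2.2.2.1.symm⟩

theorem reverse (h : G.IsSquare a b c d) : G.IsSquare d c b a :=
  ⟨h.2.2.1.symm, h.2.1.symm, h.1.symm, h.2.2.2.1.symm, h.2.2.2.2.2.symm, h.2.2.2.2.1.symm⟩

theorem isCycle_walk (h : G.IsSquare a b c d) : h.walk.IsCycle := by
  obtain ⟨h1, h2, h3, h4, h5, h6⟩ := h
  have n1 := h1.ne
  have n2 := h2.ne
  have n3 := h3.ne
  have n4 := h4.ne
  simp [walk, Walk.isCycle_def, Walk.isTrail_def]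
  grind


end IsSquare

/-- The vertices of a non-trivial walk are exactly the endpoints of its edges. -/
theorem Walk.IsCycle.toSubgraph_eq_of_edgeSet_eq {p : G.Walk a a} {q : G.Walk b b}
    (hp : p.IsCycle) (hq : q.IsCycle) (h : p.toSubgraph.edgeSet = q.toSubgraph.edgeSet) :
    p.toSubgraph = q.toSubgraph := by
  have hadj : ∀ x y, p.toSubgraph.Adj x y ↔ q.toSubgraph.Adj x y := fun x y => by
    rw [← Subgraph.mem_edgeSet, ← Subgraph.mem_edgeSet, h]
  ext x y
  · rw [Walk.mem_verts_toSubgraph, Walk.mem_verts_toSubgraph,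
      Walk.mem_support_iff_exists_mem_edges_of_not_nil hp.not_nil,
      Walk.mem_support_iff_exists_mem_edges_of_not_nil hq.not_nil]
    simp only [← Walk.mem_edges_toSubgraph, h]
  · exact hadj x y

theorem Walk.IsCycle.ncard_edgeSet_toSubgraph {p : G.Walk a a} (hp : p.IsCycle) :
    p.toSubgraph.edgeSet.ncard = p.length := by
  classical
  rw [Walk.edgeSet_toSubgraph, ← Walk.length_edges, ← List.toFinset_card_of_nodup hp.edges_nodup,
    ← Set.ncard_coe_finset]
  congr 1
  ext e
  simp

theorem Subgraph.IsCycleOfLength.ncard_edgeSet {C : G.Subgraph} {n : ℕ}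
    (h : C.IsCycleOfLength n) : C.edgeSet.ncard = n := by
  obtain ⟨v, p, hp, rfl, rfl⟩ := h
  exact hp.ncard_edgeSet_toSubgraph

theorem Subgraph.IsCycleOfLength.eq_of_edgeSet_eq {C D : G.Subgraph} {m n : ℕ}
    (hC : C.IsCycleOfLength m) (hD : D.IsCycleOfLength n) (h : C.edgeSet = D.edgeSet) :
    C = D := by
  obtain ⟨v, p, hp, rfl, rfl⟩ := hC
  obtain ⟨w, q, hq, rfl, rfl⟩ := hD
  exact hp.toSubgraph_eq_of_edgeSet_eq hq h

/-- The edges of the closed walk `a, b, c, d, a`. -/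
def squareEdges [DecidableEq V] (q : V × V × V × V) : Finset (Sym2 V) :=
  {s(q.1, q.2.1), s(q.2.1, q.2.2.1), s(q.2.2.1, q.2.2.2), s(q.2.2.2, q.1)}

theorem IsSquare.edgeSet_toSubgraph_walk [DecidableEq V] (h : G.IsSquare a b c d) :
    h.walk.toSubgraph.edgeSet = (squareEdges (a, b, c, d) : Set (Sym2 V)) := by
  ext e
  simp [h.edges_walk, squareEdges]

theorem Subgraph.isCycleOfLength_four_iff [DecidableEq V] {C : G.Subgraph} :
    C.IsCycleOfLength 4 ↔
      ∃ a b c d, ∃ h : G.IsSquare a b c d, h.walk.toSubgraph = C := by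
  constructor
  · rintro ⟨v, p, hp, hl, rfl⟩
    cases p with
    | nil => simp at hl
    | @cons _ b _ h1 p => cases p with
    | nil => simp at hl
    | @cons _ c _ h2 p => cases p with
    | nil => simp at hl
    | @cons _ d _ h3 p => cases p with
    | nil => simp at hl
    | @cons _ e _ h4 p =>
      cases p with
      | nil =>
        refine ⟨v, b, c, d, ⟨h1, h2, h3, h4, ?_, ?_⟩, rfl⟩
        · have := hp.support_nodup
          simp at this
          grind
        · have := hp.support_nodup
          simp at this
          grind
      | cons h5 p => simp at hl
  · rintro ⟨a, b, c, d, h, rfl⟩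
    exact ⟨a, h.walk, h.isCycle_walk, rfl, rfl⟩

/-- The eight tuples are the orbit of the dihedral group: four starting points, two directions. -/
theorem IsSquare.squareEdges_eq_iff [DecidableEq V] (h : G.IsSquare a b c d) (x y z w : V) :
    G.IsSquare x y z w ∧ squareEdges (x, y, z, w) = squareEdges (a, b, c, d) ↔
      (x, y, z, w) ∈ ({(a, b, c, d), (b, c, d, a), (c, d, a, b), (d, a, b, c), (d, c, b, a),
        (c, b, a, d), (b, a, d, c), (a, d, c, b)} : Finset (V × V × V × V)) := by
  constructor
  · rintro ⟨h', he⟩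
    have h1 : s(x, y) ∈ squareEdges (a, b, c, d) := he ▸ by simp [squareEdges]
    have h2 : s(y, z) ∈ squareEdges (a, b, c, d) := he ▸ by simp [squareEdges]
    have h3 : s(z, w) ∈ squareEdges (a, b, c, d) := he ▸ by simp [squareEdges]
    obtain ⟨-, -, -, -, n1, n2⟩ := h'
    simp only [squareEdges, Finset.mem_insert, Finset.mem_singleton, Sym2.eq_iff] at h1 h2 h3
    obtain ⟨g1, g2, g3, g4, g5, g6⟩ := h
    have m1 := g1.ne
    have m2 := g2.ne
    have m3 := g3.ne
    have m4 := g4.ne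
    simp only [Finset.mem_insert, Finset.mem_singleton, Prod.mk.injEq]
    rcases h1 with (⟨rfl, rfl⟩ | ⟨rfl, rfl⟩) | (⟨rfl, rfl⟩ | ⟨rfl, rfl⟩) |
      (⟨rfl, rfl⟩ | ⟨rfl, rfl⟩) | (⟨rfl, rfl⟩ | ⟨rfl, rfl⟩) <;> grind
  · intro hm
    simp only [Finset.mem_insert, Finset.mem_singleton, Prod.mk.injEq] at hm
    rcases hm with ⟨rfl, rfl, rfl, rfl⟩ | ⟨rfl, rfl, rfl, rfl⟩ | ⟨rfl, rfl, rfl, rfl⟩ |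
      ⟨rfl, rfl, rfl, rfl⟩ | ⟨rfl, rfl, rfl, rfl⟩ | ⟨rfl, rfl, rfl, rfl⟩ | ⟨rfl, rfl, rfl, rfl⟩ |
      ⟨rfl, rfl, rfl, rfl⟩
    · exact ⟨h, rfl⟩
    · exact ⟨h.rotate, by ext; simp [squareEdges]; tauto⟩
    · exact ⟨h.rotate.rotate, by ext; simp [squareEdges]; tauto⟩
    · exact ⟨h.rotate.rotate.rotate, by ext; simp [squareEdges]; tauto⟩
    · exact ⟨h.reverse, by ext; simp [squareEdges, Sym2.eq_swap]; tauto⟩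
    · exact ⟨h.reverse.rotate, by ext; simp [squareEdges, Sym2.eq_swap]; tauto⟩
    · exact ⟨h.reverse.rotate.rotate, by ext; simp [squareEdges, Sym2.eq_swap]; tauto⟩
    · exact ⟨h.reverse.rotate.rotate.rotate, by ext; simp [squareEdges, Sym2.eq_swap]; tauto⟩

section Counting

variable [Fintype V]

open Classical in
/-- The squares of `G`, as ordered quadruples. -/
noncomputable def squares (G : SimpleGraph V) : Finset (V × V × V × V) :=
  {q | G.IsSquare q.1 q.2.1 q.2.2.1 q.2.2.2}

open Classical in
theorem numFourCycles_eq_card_image (G : SimpleGraph V) :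
    G.numFourCycles = (G.squares.image squareEdges).card := by
  rw [numFourCycles, ← Set.ncard_coe_finset]
  have hinj : Set.InjOn (fun C : G.Subgraph => C.edgeSet) {C | C.IsCycleOfLength 4} :=
    fun C hC D hD h => Subgraph.IsCycleOfLength.eq_of_edgeSet_eq hC hD h
  rw [← hinj.ncard_image,
    ← Set.ncard_image_of_injective _ (Finset.coe_injective (α := Sym2 V))]
  congr 1
  ext E
  simp only [Set.mem_image, Set.mem_ofPred_eq, Subgraph.isCycleOfLength_four_iff, Finset.coe_image,
    squares, Finset.coe_filter, Finset.mem_univ, true_and, exists_exists_and_eq_and]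
  constructor
  · rintro ⟨C, ⟨a, b, c, d, h, rfl⟩, rfl⟩
    exact ⟨(a, b, c, d), h, h.edgeSet_toSubgraph_walk.symm⟩
  · rintro ⟨⟨a, b, c, d⟩, h, rfl⟩
    exact ⟨_, ⟨a, b, c, d, h, rfl⟩, IsSquare.edgeSet_toSubgraph_walk h⟩

theorem card_squares (G : SimpleGraph V) : G.squares.card = 8 * G.numFourCycles := by
  classical
  rw [numFourCycles_eq_card_image, Finset.card_eq_sum_card_image squareEdges G.squares,
    Finset.sum_const_nat (m := 8) ?_, mul_comm]
  simp only [Finset.mem_image]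
  rintro _ ⟨⟨a, b, c, d⟩, h, rfl⟩
  simp only [squares, Finset.mem_filter, Finset.mem_univ, true_and] at h
  have : {q ∈ G.squares | squareEdges q = squareEdges (a, b, c, d)} =
      {(a, b, c, d), (b, c, d, a), (c, d, a, b), (d, a, b, c), (d, c, b, a),
        (c, b, a, d), (b, a, d, c), (a, d, c, b)} := by
    ext ⟨x, y, z, w⟩
    rw [← h.squareEdges_eq_iff]
    simp [squares]
  rw [this]
  obtain ⟨g1, g2, g3, g4, g5, g6⟩ := h
  have m1 := g1.ne
  have m2 := g2.ne
  have m3 := g3.ne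
  have m4 := g4.ne
  repeat rw [Finset.card_insert_of_notMem (by
    simp only [Finset.mem_insert, Finset.mem_singleton, Prod.mk.injEq]; grind)]
  simp

open Classical in
/-- The ordered quadruples of pairwise adjacent vertices. -/
noncomputable def fourCliqueTuples (G : SimpleGraph V) : Finset (V × V × V × V) :=
  {q | G.IsSquare q.1 q.2.1 q.2.2.1 q.2.2.2 ∧ G.IsSquare q.1 q.2.1 q.2.2.2 q.2.2.1}

/-- Each `K_4` has `4! = 24` orderings; only the upper bound is needed, as these tuples enter the
count as a surplus. -/
theorem card_fourCliqueTuples_le [DecidableEq V] [DecidableRel G.Adj] :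
    G.fourCliqueTuples.card ≤ 24 * (G.cliqueFinset 4).card := by
  refine Finset.card_le_mul_card_image_of_maps_to
    (f := fun q : V × V × V × V => ({q.1, q.2.1, q.2.2.1, q.2.2.2} : Finset V)) ?_ 24 ?_
  · rintro ⟨a, b, c, d⟩ h
    simp only [fourCliqueTuples, Finset.mem_filter, Finset.mem_univ, true_and] at h
    obtain ⟨⟨h1, h2, h3, h4, -, -⟩, -, h5, -, h6, -, -⟩ := h
    rw [mem_cliqueFinset_iff]
    refine IsNClique.insert (is3Clique_iff.2 ⟨b, c, d, h2, h5, h3, rfl⟩) ?_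
    simp [h1, h4.symm, h6.symm]
  · intro s hs
    have hs4 : s.card = 4 := (mem_cliqueFinset_iff.1 hs).card_eq
    have : (s.toList.permutations.toFinset).card ≤ 24 := by
      refine (List.toFinset_card_le _).trans ?_
      rw [List.length_permutations, Finset.length_toList, hs4]
      decide
    refine le_trans (Finset.card_le_card_of_injOn
      (fun q : V × V × V × V => [q.1, q.2.1, q.2.2.1, q.2.2.2]) ?_ ?_) this
    · rintro ⟨a, b, c, d⟩ h
      simp only [fourCliqueTuples, Finset.coe_filter, Finset.mem_filter, Finset.mem_univ,
        true_and, Set.mem_ofPred_eq] at h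
      obtain ⟨⟨⟨h1, h2, h3, h4, h7, h8⟩, -, h5, -, h6, -, -⟩, rfl⟩ := h
      simp only [List.coe_toFinset, List.mem_permutations, Set.mem_ofPred_eq]
      refine List.perm_of_nodup_nodup_toFinset_eq ?_ (Finset.nodup_toList _) (by simp)
      simp [h1.ne, h2.ne, h3.ne, h4.ne.symm, h7, h8]
    · rintro ⟨a, b, c, d⟩ - ⟨a', b', c', d'⟩ - h
      simpa using h

end Counting

end

/-! ### Double counting edges and their opposites -/

section

variable {V : Type*} [Fintype V] {G : SimpleGraph V} {u v : V}

open Classical in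
/-- The pairs of adjacent vertices of `G`. -/
noncomputable def adjPairs (G : SimpleGraph V) : Finset (V × V) :=
  Finset.univ.filter fun p => G.Adj p.1 p.2

@[simp]
theorem mem_adjPairs {p : V × V} : p ∈ G.adjPairs ↔ G.Adj p.1 p.2 := by simp [adjPairs]

theorem card_adjPairs (G : SimpleGraph V) : G.adjPairs.card = 2 * Nat.card G.edgeSet := by
  classical
  rw [Nat.card_eq_fintype_card, ← edgeFinset_card, two_mul_card_edgeFinset]
  rfl

open Classical in
/-- Counting the edges opposite to `uv`. -/
theorem card_opposite (G : SimpleGraph V) (u v : V) :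
    2 * Nat.card G.edgeSet +
        (Finset.univ.filter fun p : V × V =>
          G.IsSquare u v p.1 p.2 ∧ G.IsSquare u v p.2 p.1).card =
      2 * Nat.card (G.deleteOpposite u v).edgeSet +
        2 * (Finset.univ.filter fun p : V × V => G.IsSquare u v p.1 p.2).card := by
  have hswap : (Finset.univ.filter fun p : V × V => G.IsSquare u v p.2 p.1).card =
      (Finset.univ.filter fun p : V × V => G.IsSquare u v p.1 p.2).card :=
    Finset.card_equiv (Equiv.prodComm V V) (by simp)
  have hsplit := Finset.card_filter_add_card_filter_not
    (s := G.adjPairs)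
    (fun p => G.IsSquare u v p.1 p.2 ∨ G.IsSquare u v p.2 p.1)
  rw [adjPairs, Finset.filter_filter, Finset.filter_filter, ← adjPairs] at hsplit
  have h1 : (Finset.univ.filter fun p : V × V => G.Adj p.1 p.2 ∧
      (G.IsSquare u v p.1 p.2 ∨ G.IsSquare u v p.2 p.1)) =
      (Finset.univ.filter fun p : V × V => G.IsSquare u v p.1 p.2) ∪
      (Finset.univ.filter fun p : V × V => G.IsSquare u v p.2 p.1) := by
    ext p
    simp only [Finset.mem_filter, Finset.mem_univ, true_and, Finset.mem_union,
      and_iff_right_iff_imp]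
    rintro (h | h)
    · exact h.2.2.1
    · exact h.2.2.1.symm
  have h2 : (Finset.univ.filter fun p : V × V => G.Adj p.1 p.2 ∧
      ¬ (G.IsSquare u v p.1 p.2 ∨ G.IsSquare u v p.2 p.1)).card =
      2 * Nat.card (G.deleteOpposite u v).edgeSet := by
    rw [← card_adjPairs]
    congr 1
    ext p
    simp [deleteOpposite_adj]
  have h3 := Finset.card_union_add_card_inter
    (Finset.univ.filter fun p : V × V => G.IsSquare u v p.1 p.2)
    (Finset.univ.filter fun p : V × V => G.IsSquare u v p.2 p.1)
  rw [← Finset.filter_and] at h3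
  rw [h1, h2, card_adjPairs] at hsplit
  omega

open Classical in
theorem card_filter_quadruples (P : V → V → V → V → Prop)
    (hP : ∀ a b c d, P a b c d → G.Adj a b) :
    (Finset.univ.filter fun q : V × V × V × V => P q.1 q.2.1 q.2.2.1 q.2.2.2).card =
      ∑ e ∈ G.adjPairs,
        (Finset.univ.filter fun p : V × V => P e.1 e.2 p.1 p.2).card := by
  rw [Finset.card_eq_sum_card_fiberwise (f := fun q : V × V × V × V => (q.1, q.2.1))
    (t := G.adjPairs)]
  · refine Finset.sum_congr rfl fun e _ => ?_
    refine Finset.card_bij (fun q _ => q.2.2) ?_ ?_ ?_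
    · rintro ⟨a, b, c, d⟩ h
      simp only [Finset.mem_filter, Finset.mem_univ, true_and] at h ⊢
      obtain ⟨h, rfl⟩ := h
      exact h
    · rintro ⟨a, b, c, d⟩ h ⟨a', b', c', d'⟩ h' heq
      simp only [Finset.mem_filter, Finset.mem_univ, true_and] at h h'
      obtain ⟨h, rfl⟩ := h
      grind
    · rintro ⟨c, d⟩ h
      refine ⟨(e.1, e.2, c, d), ?_, rfl⟩
      simpa using h
  · rintro ⟨a, b, c, d⟩ h
    simp only [Finset.coe_filter, Finset.mem_univ, true_and, Set.mem_ofPred_eq] at h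
    rw [Finset.mem_coe, mem_adjPairs]
    exact hP _ _ _ _ h

-- The sum of `card_opposite` over the `2e` ordered adjacent pairs; the 16 is `2 * 8`, each 4-cycle
-- being eight quadruples.
open Classical in
theorem numFourCycles_identity (G : SimpleGraph V) :
    16 * G.numFourCycles + 2 * ∑ p ∈ G.adjPairs,
        Nat.card (G.deleteOpposite p.1 p.2).edgeSet =
      4 * Nat.card G.edgeSet * Nat.card G.edgeSet + G.fourCliqueTuples.card := by
  have h1 : G.squares.card = _ :=
    card_filter_quadruples (G := G) G.IsSquare (fun _ _ _ _ h => h.1)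
  have h2 : G.fourCliqueTuples.card = ∑ e ∈ G.adjPairs, (Finset.univ.filter fun p : V × V =>
      G.IsSquare e.1 e.2 p.1 p.2 ∧ G.IsSquare e.1 e.2 p.2 p.1).card := by
    rw [fourCliqueTuples]
    convert card_filter_quadruples (G := G)
      (fun a b c d => G.IsSquare a b c d ∧ G.IsSquare a b d c) (fun _ _ _ _ h => h.1.1)
  have h3 := Finset.sum_congr (rfl : G.adjPairs = _)
    fun p _ => G.card_opposite p.1 p.2
  rw [Finset.sum_add_distrib, Finset.sum_add_distrib, ← Finset.mul_sum, ← Finset.mul_sum,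
    ← Finset.mul_sum, ← h1, ← h2, Finset.sum_const, card_adjPairs, card_squares,
    smul_eq_mul] at h3
  linarith

variable {m : ℕ}

theorem numFourCycles_le [DecidableEq V] [DecidableRel G.Adj]
    (h : ∀ u v, G.Adj u v → m ≤ Nat.card (G.deleteOpposite u v).edgeSet) :
    4 * G.numFourCycles + Nat.card G.edgeSet * m ≤
      Nat.card G.edgeSet * Nat.card G.edgeSet + 6 * (G.cliqueFinset 4).card := by
  classical
  have h1 := G.numFourCycles_identity
  have h2 := G.card_fourCliqueTuples_le
  have h3 := Finset.card_nsmul_le_sum G.adjPairs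
    (fun p => Nat.card (G.deleteOpposite p.1 p.2).edgeSet) m
    (fun p hp => h _ _ (mem_adjPairs.1 hp))
  rw [card_adjPairs, smul_eq_mul] at h3
  linarith

/-- A single edge whose deletion leaves more than `m` edges would make the summed bound strict. -/
theorem card_deleteOpposite_of_numFourCycles_ge [DecidableEq V] [DecidableRel G.Adj]
    (h : ∀ u v, G.Adj u v → m ≤ Nat.card (G.deleteOpposite u v).edgeSet)
    (heq : Nat.card G.edgeSet * Nat.card G.edgeSet + 6 * (G.cliqueFinset 4).card ≤
      4 * G.numFourCycles + Nat.card G.edgeSet * m) (huv : G.Adj u v) :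
    Nat.card (G.deleteOpposite u v).edgeSet = m := by
  classical
  refine le_antisymm ?_ (h u v huv)
  by_contra! hlt
  have h1 := G.numFourCycles_identity
  have h2 := G.card_fourCliqueTuples_le
  have h3 : ∑ p ∈ G.adjPairs, m <
      ∑ p ∈ G.adjPairs,
        Nat.card (G.deleteOpposite p.1 p.2).edgeSet :=
    Finset.sum_lt_sum (fun p hp => h _ _ (mem_adjPairs.1 hp))
      ⟨(u, v), by simpa using huv, hlt⟩
  rw [Finset.sum_const, card_adjPairs, smul_eq_mul] at h3
  linarith

theorem le_numFourCycles
    (h : ∀ u v, G.Adj u v → Nat.card (G.deleteOpposite u v).edgeSet = m) :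
    Nat.card G.edgeSet * Nat.card G.edgeSet ≤ 4 * G.numFourCycles + Nat.card G.edgeSet * m := by
  classical
  have h1 := G.numFourCycles_identity
  have h3 := Finset.sum_const_nat (s := G.adjPairs)
    (m := m) (f := fun p => Nat.card (G.deleteOpposite p.1 p.2).edgeSet)
    (fun p hp => h _ _ (mem_adjPairs.1 hp))
  rw [card_adjPairs] at h3
  rw [h3] at h1
  linarith

end

/-! ### Non-bipartite graphs and complete bipartite graphs -/

section

variable {V : Type*} {G : SimpleGraph V} {u v x y z : V}

theorem triangle_not_colorable_two (h1 : G.Adj x y) (h2 : G.Adj y z) (h3 : G.Adj x z) :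
    ¬ G.Colorable 2 := by
  rw [colorable_two_iff]
  rintro ⟨f, hf⟩
  have h1 := hf _ _ h1
  have h2 := hf _ _ h2
  have h3 := hf _ _ h3
  revert h1 h2 h3
  cases f x <;> cases f y <;> cases f z <;> simp

theorem HasOddCycle.not_colorable_two (h : G.HasOddCycle) : ¬ G.Colorable 2 := by
  obtain ⟨-, n, hn, v, p, -, rfl, -⟩ := h
  intro hc
  exact Nat.not_even_iff_odd.2 hn (two_colorable_iff_forall_loop_even.1 hc v p)

theorem Connected.card_le_card_edgeSet [Finite V] (hG : G.Connected) (hc : ¬ G.Colorable 2) :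
    Nat.card V ≤ Nat.card G.edgeSet := by
  have h := hG.card_vert_le_card_edgeSet_add_one
  by_contra! hlt
  exact hc (isTree_iff_connected_and_card.2 ⟨hG, by omega⟩).colorable_two

theorem Connected.card_le_card_edgeSet_deleteOpposite [Finite V] (hG : G.Connected)
    (hc : ¬ G.Colorable 2) (u v : V) (huv : G.Adj u v) :
    Nat.card V ≤ Nat.card (G.deleteOpposite u v).edgeSet :=
  (hG.deleteOpposite huv).card_le_card_edgeSet fun h => hc (colorable_two_of_deleteOpposite huv h)

/-- A connected graph with as many edges as vertices becomes a tree when a side of a square is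
removed, and the tree's 2-colouring would pass back to `G`. -/
theorem not_isSquare_deleteOpposite [Finite V] (hG : G.Connected) (hc : ¬ G.Colorable 2)
    (hcard : ∀ u v, G.Adj u v → Nat.card (G.deleteOpposite u v).edgeSet = Nat.card V)
    (u v : V) (huv : G.Adj u v) (a b c d : V) : ¬ (G.deleteOpposite u v).IsSquare a b c d :=
  fun h => hc <| colorable_two_of_deleteOpposite huv <|
    h.colorable_two (hG.deleteOpposite huv) (hcard u v huv)

/-- A connected graph is bipartite if every edge lies in a square and every edge `uv` is opposite
to some edge of each square. -/
theorem colorable_two_of_not_isSquare_deleteOpposite (hG : G.Connected)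
    (hsq : ∀ u v, G.Adj u v → ∃ x y, G.IsSquare u v x y)
    (hno : ∀ u v, G.Adj u v → ∀ a b c d, ¬ (G.deleteOpposite u v).IsSquare a b c d) :
    G.Colorable 2 := by
  -- two triangles on a common edge form a square
  have hunique : ∀ u v w w', G.Adj u v → G.Adj u w → G.Adj v w → G.Adj u w' → G.Adj v w' →
      w = w' := by
    intro u v w w' huv huw hvw huw' hvw'
    by_contra hne
    exact hno u v huv u w v w' ⟨huw.deleteOpposite_left, hvw.deleteOpposite_right.symm,
      hvw'.deleteOpposite_right, huw'.deleteOpposite_left.symm, huv.ne, hne⟩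
  have htri : ∀ u v w, G.Adj u v → G.Adj v w → ¬ G.Adj u w := by
    intro u v w huv hvw huw
    obtain ⟨y, x, -, hvy, hyx, hxu, huy, hvx⟩ := hsq u v huv
    have hnuy : ¬ G.Adj u y := fun huy' => by
      obtain rfl := hunique u v w y huv huw hvw huy' hvy
      exact hvx (hunique u w v x huw huv hvw.symm hxu.symm hyx)
    have hnwy : ¬ G.Adj w y := fun hwy =>
      huy (hunique v w u y hvw huv.symm huw.symm hvy hwy)
    -- For a triangle `u v w`, the square `u v y x` on `uv` survives the deletion for `uw`, because
    -- `y` is adjacent to neither `u` nor `w`.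
    refine hno u w huw u v y x ⟨huv.deleteOpposite_left, ⟨hvy, ?_, ?_⟩, ⟨hyx, ?_, ?_⟩,
      hxu.symm.deleteOpposite_left.symm, huy, hvx⟩
    · exact fun s => hnuy s.2.2.2.1.symm
    · exact fun s => hnwy s.2.1
    · exact fun s => hnwy s.2.1
    · exact fun s => hnuy s.2.2.2.1.symm
  classical
  by_cases hbot : ∃ u v, G.Adj u v
  · obtain ⟨u, v, huv⟩ := hbot
    have hcover := adj_or_adj_of_path_three hG
      (fun v u x w h1 h2 h3 h4 => adj_of_path_three htri hsq hno h1 h2 h3 h4) huv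
    rw [colorable_two_iff]
    refine ⟨fun x => decide (G.Adj u x), fun x y hxy => ?_⟩
    have h1 := hcover x
    have h2 := hcover y
    have h3 := htri u x y
    have h4 := htri v x y
    grind
  · push Not at hbot
    rw [colorable_two_iff]
    exact ⟨fun _ => true, fun x y h => absurd h (hbot x y)⟩

/-- A graph is complete bipartite if its edges are the pairs of which exactly one vertex is
adjacent to `v`. -/
theorem isCompleteBipartiteGraph_of_adj_iff [Fintype V] (huv : G.Adj u v)
    (h : ∀ x y, G.Adj x y ↔ (G.Adj v x ↔ ¬ G.Adj v y)) : G.IsCompleteBipartiteGraph := by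
  classical
  refine ⟨Fintype.card {x // G.Adj v x}, Fintype.card {x // ¬ G.Adj v x},
    Fintype.card_pos_iff.2 ⟨u, huv.symm⟩, Fintype.card_pos_iff.2 ⟨v, G.irrefl⟩, ⟨?_⟩⟩
  let ψ : completeBipartiteGraph {x // G.Adj v x} {x // ¬ G.Adj v x} ≃g G :=
    ⟨Equiv.sumCompl fun x => G.Adj v x, ?_⟩
  · exact (completeBipartiteGraphCongr (Fintype.equivFin _) (Fintype.equivFin _)).comp ψ.symm
  rintro (⟨x, hx⟩ | ⟨x, hx⟩) (⟨y, hy⟩ | ⟨y, hy⟩) <;> rw [h] <;> simp [hx, hy]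

theorem IsCompleteBipartiteGraph.exists_adj_iff (h : G.IsCompleteBipartiteGraph) :
    ∃ f : V → Bool, ∀ x y, G.Adj x y ↔ f x ≠ f y := by
  obtain ⟨l, m, -, -, ⟨φ⟩⟩ := h
  refine ⟨fun x => (φ x).isLeft, fun x y => ?_⟩
  rw [← φ.map_adj_iff]
  beta_reduce
  generalize φ x = p
  generalize φ y = q
  cases p <;> cases q <;> simp

/-- Deleting the edges opposite to an edge of a complete bipartite graph leaves a tree. -/
theorem card_edgeSet_deleteOpposite_of_adj_iff [Fintype V] {f : V → Bool}
    (h : ∀ x y, G.Adj x y ↔ f x ≠ f y) (huv : G.Adj u v) :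
    Nat.card (G.deleteOpposite u v).edgeSet < Nat.card V := by
  classical
  -- Every surviving edge meets `u` or `v`. These edges are indexed by the vertices `w ≠ u`, with `w
  -- = v` giving `uv` itself, so there are at most `d - 1` of them.
  have hsub : (G.deleteOpposite u v).edgeSet ⊆
      ((Finset.univ.erase u).image fun w => if G.Adj v w then s(v, w) else s(u, w) :
        Finset (Sym2 V)) := by
    have key : ∀ x y, G.Adj x y → x = u ∨ x = v → s(x, y) ∈
        ((Finset.univ.erase u).image fun w => if G.Adj v w then s(v, w) else s(u, w)) := by
      intro x y hxy hx
      have hfuv := (h u v).1 huv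
      rw [Finset.mem_image]
      rcases hx with rfl | rfl
      · refine ⟨y, by simpa using hxy.ne', if_neg fun hvy => ?_⟩
        have h1 := (h x y).1 hxy
        have h2 := (h v y).1 hvy
        revert h1 h2 hfuv
        cases f x <;> cases f v <;> cases f y <;> simp
      · by_cases hy : y = u
        · subst hy
          exact ⟨x, by simpa using hxy.ne, by simp [Sym2.eq_swap]⟩
        · exact ⟨y, by simpa using hy, if_pos hxy⟩
    intro e
    induction e with | _ x y
    rintro ⟨hxy, h1, h2⟩
    rw [Finset.mem_coe]
    by_cases hx : x = u ∨ x = v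
    · exact key x y hxy hx
    by_cases hy : y = u ∨ y = v
    · rw [Sym2.eq_swap]
      exact key y x hxy.symm hy
    exfalso
    simp only [IsSquare, h] at h1 h2 hxy huv
    grind
  rw [Nat.card_coe_set_eq, Nat.card_eq_fintype_card]
  refine (Set.ncard_le_ncard hsub).trans_lt ?_
  rw [Set.ncard_coe_finset]
  refine Finset.card_image_le.trans_lt ?_
  exact Finset.card_lt_card (Finset.erase_ssubset (Finset.mem_univ u))

end

/-! ### Graphs with one cycle, and equality in the bipartite case -/

section

variable {V : Type*} {G : SimpleGraph V} {a b c d u v x y : V}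

theorem Connected.deleteEdge_of_mem_cycle (hG : G.Connected) {p : G.Walk u u} (hp : p.IsCycle)
    (hxy : s(x, y) ∈ p.edges) : (G.deleteEdges {s(x, y)}).Connected :=
  hG.connected_delete_edge_of_not_isBridge fun h => h.notMem_edges_of_isCycle hp hxy

/-- In a connected graph with as many edges as vertices, any two cycles have the same edges. -/
theorem Connected.edges_subset_of_card_eq [Finite V] (hG : G.Connected)
    (hcard : Nat.card G.edgeSet = Nat.card V) {p : G.Walk u u} {q : G.Walk v v}
    (hp : p.IsCycle) (hq : q.IsCycle) : p.edges ⊆ q.edges := by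
  intro e he
  induction e with | _ x y
  by_contra hne
  have hadj : G.Adj x y := p.adj_of_mem_edges he
  have htree : (G.deleteEdges {s(x, y)}).IsTree := by
    rw [isTree_iff_connected_and_card]
    exact ⟨hG.deleteEdge_of_mem_cycle hp he, by rw [card_edgeSet_deleteEdge hadj, hcard]⟩
  exact htree.isAcyclic _ (Walk.IsCycle.toDeleteEdges G {s(x, y)} hq
    (by rintro e h rfl; exact hne h))

theorem HasOddCycle.hasUniqueCycleOdd [Finite V] (h : G.HasOddCycle) (hG : G.Connected)
    (hcard : Nat.card G.edgeSet = Nat.card V) : G.HasUniqueCycleOdd := by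
  obtain ⟨C, n, hn, hC⟩ := h
  refine ⟨C, ?_, n, hn, hC⟩
  ext D
  constructor
  · rintro ⟨m, hD⟩
    obtain ⟨v, p, hp, -, rfl⟩ := hC
    obtain ⟨w, q, hq, -, rfl⟩ := hD
    refine hq.toSubgraph_eq_of_edgeSet_eq hp ?_
    ext e
    rw [Walk.mem_edges_toSubgraph, Walk.mem_edges_toSubgraph]
    exact ⟨fun h => hG.edges_subset_of_card_eq hcard hq hp h,
      fun h => hG.edges_subset_of_card_eq hcard hp hq h⟩
  · rintro rfl
    exact ⟨n, hC⟩

/-- Removing an edge of the only cycle keeps the graph connected and leaves no cycle, hence a tree.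
-/
theorem HasUniqueCycleOdd.card_edgeSet [Finite V] (h : G.HasUniqueCycleOdd)
    (hG : G.Connected) : Nat.card G.edgeSet = Nat.card V := by
  obtain ⟨C, hcyc, n, -, v, p, hp, -, rfl⟩ := h
  obtain ⟨e, he⟩ := p.edges.exists_mem_of_ne_nil (by simp [hp.not_nil])
  induction e with | _ x y
  have htree : (G.deleteEdges {s(x, y)}).IsTree := by
    refine ⟨hG.deleteEdge_of_mem_cycle hp he, fun w q hq => ?_⟩
    have hq' := hq.mapLe (G.deleteEdges_le {s(x, y)})
    have hmem : (q.mapLe (G.deleteEdges_le {s(x, y)})).toSubgraph ∈ G.cycles :=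
      ⟨_, w, _, hq', rfl, rfl⟩
    rw [hcyc, Set.mem_singleton_iff] at hmem
    rw [← Walk.mem_edges_toSubgraph, ← hmem, Walk.mem_edges_toSubgraph,
      Walk.edges_mapLe_eq_edges] at he
    have := q.edges_subset_edgeSet he
    simp at this
  rw [← (isTree_iff_connected_and_card.1 htree).2,
    card_edgeSet_deleteEdge (p.adj_of_mem_edges he)]

theorem HasUniqueCycleOdd.not_isSquare (h : G.HasUniqueCycleOdd) : ¬ G.IsSquare a b c d := by
  intro hs
  obtain ⟨C, hcyc, n, hn, hC⟩ := h
  have h4 : hs.walk.toSubgraph.IsCycleOfLength 4 := ⟨a, hs.walk, hs.isCycle_walk, rfl, rfl⟩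
  have hmem : hs.walk.toSubgraph ∈ G.cycles := ⟨4, h4⟩
  rw [hcyc, Set.mem_singleton_iff] at hmem
  have h1 := h4.ncard_edgeSet
  rw [hmem, hC.ncard_edgeSet] at h1
  subst h1
  exact absurd hn (by decide)

theorem numFourCycles_eq_zero [Fintype V] (h : ∀ a b c d, ¬ G.IsSquare a b c d) :
    G.numFourCycles = 0 := by
  have h1 := G.card_squares
  have h2 : G.squares = ∅ := by
    ext
    simp [squares, h]
  rw [h2, Finset.card_empty] at h1
  omega

/-- If deleting the edges opposite to an edge of a connected bipartite graph always leaves a tree,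
then the graph is a tree or complete bipartite. -/
theorem Connected.isTree_or_isCompleteBipartiteGraph [Fintype V] (hG : G.Connected)
    (hb : G.IsBipartite)
    (h : ∀ u v, G.Adj u v → Nat.card (G.deleteOpposite u v).edgeSet + 1 = Nat.card V) :
    G.IsTree ∨ G.IsCompleteBipartiteGraph := by
  by_cases ht : G.IsTree
  · exact Or.inl ht
  right
  have hle := hG.card_vert_le_card_edgeSet_add_one
  have hne : Nat.card G.edgeSet + 1 ≠ Nat.card V := fun h =>
    ht (isTree_iff_connected_and_card.2 ⟨hG, h⟩)
  have hsq : ∀ u v, G.Adj u v → ∃ x y, G.IsSquare u v x y := fun u v huv =>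
    exists_isSquare_of_card_lt (by have := h u v huv; omega)
  have hno : ∀ u v, G.Adj u v → ∀ a b c d, ¬ (G.deleteOpposite u v).IsSquare a b c d :=
    fun u v huv a b c d =>
      (isTree_iff_connected_and_card.2 ⟨hG.deleteOpposite huv, h u v huv⟩).not_isSquare
  have htri : ∀ x y z, G.Adj x y → G.Adj y z → ¬ G.Adj x z := fun x y z h1 h2 h3 =>
    triangle_not_colorable_two h1 h2 h3 hb
  have hpath : ∀ v u x w, G.Adj v u → G.Adj u x → G.Adj x w → v ≠ x → G.Adj v w :=
    fun v u x w h1 h2 h3 h4 => adj_of_path_three htri hsq hno h1 h2 h3 h4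
  have hpos : 0 < Nat.card G.edgeSet := by
    have := hG.nonempty
    have : 0 < Nat.card V := Nat.card_pos
    omega
  obtain ⟨⟨e, he⟩⟩ := (Nat.card_pos_iff.1 hpos).1
  induction e with | _ u v
  have huv : G.Adj u v := he
  refine isCompleteBipartiteGraph_of_adj_iff huv fun x y => ?_
  have hcover := fun x => adj_or_adj_of_path_three hG hpath huv x
  constructor
  · intro hxy
    have h1 := hcover x
    have h2 := hcover y
    have h3 := htri u x y
    have h4 := htri v x y
    grind
  · intro hxy
    have key : ∀ x y, G.Adj v x → ¬ G.Adj v y → G.Adj x y := fun x y hx hy =>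
      (adj_or_adj_of_path_three hG hpath hx y).resolve_left hy
    by_cases hx : G.Adj v x
    · exact key x y hx (hxy.1 hx)
    · exact (key y x (by tauto) hx).symm

end

end SimpleGraph

/-! ### The three cases of the theorem -/

open SimpleGraph in
theorem proposition1p2 {V : Type*} [Fintype V] [DecidableEq V] (G : SimpleGraph V)
    [DecidableRel G.Adj] (hG : G.Connected) (d e : ℕ)
    (hd : Fintype.card V = d) (he : G.edgeFinset.card = e) :
    (G.IsBipartite →
      (G.numFourCycles : ℚ) ≤ (e : ℚ) * ((e : ℚ) - (d : ℚ) + 1) / 4 ∧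
      ((G.numFourCycles : ℚ) = (e : ℚ) * ((e : ℚ) - (d : ℚ) + 1) / 4 ↔
        G.IsTree ∨ G.IsCompleteBipartiteGraph)) ∧
    (G.HasOddCycle → G.CliqueFree 4 →
      (G.numFourCycles : ℚ) ≤ (e : ℚ) * ((e : ℚ) - (d : ℚ)) / 4 ∧
      ((G.numFourCycles : ℚ) = (e : ℚ) * ((e : ℚ) - (d : ℚ)) / 4 ↔
        G.HasUniqueCycleOdd)) ∧
    (¬ G.CliqueFree 4 →
      (G.numFourCycles : ℚ) < (e : ℚ) * ((e : ℚ) - (d : ℚ)) / 4 +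
        3 / 2 * ((G.cliqueFinset 4).card : ℚ)) := by
  have hd' : Nat.card V = d := by rw [Nat.card_eq_fintype_card, hd]
  have he' : Nat.card G.edgeSet = e := by rw [Nat.card_eq_fintype_card, ← edgeFinset_card, he]
  refine ⟨fun hb => ?_, fun hodd hfree => ?_, fun hK => ?_⟩
  · have hpos : 0 < Nat.card V := by
      have := hG.nonempty
      exact Nat.card_pos
    -- The number `n = d - 1` of edges of a spanning tree is the lower bound `m` here.
    obtain ⟨n, rfl⟩ : ∃ n, d = n + 1 := ⟨d - 1, by omega⟩
    have hfree : (G.cliqueFinset 4).card = 0 := by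
      rw [Finset.card_eq_zero, cliqueFinset_eq_empty_iff]
      exact hb.cliqueFree (by norm_num)
    have hn : ∀ u v, G.Adj u v → n ≤ Nat.card (G.deleteOpposite u v).edgeSet := fun u v huv => by
      have := (hG.deleteOpposite huv).card_vert_le_card_edgeSet_add_one
      omega
    have hle := numFourCycles_le hn
    rw [he', hfree] at hle
    have hleQ : 4 * (G.numFourCycles : ℚ) + e * n ≤ e * e := by exact_mod_cast hle
    push_cast
    refine ⟨by linarith, fun heq => ?_, ?_⟩
    · refine hG.isTree_or_isCompleteBipartiteGraph hb fun u v huv => ?_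
      rw [card_deleteOpposite_of_numFourCycles_ge hn ?_ huv, hd']
      rw [he', hfree]
      have : (e : ℚ) * e ≤ 4 * G.numFourCycles + e * n := by linarith
      exact_mod_cast this
    · rintro (ht | hcb)
      · rw [numFourCycles_eq_zero fun _ _ _ _ => ht.not_isSquare]
        have := (isTree_iff_connected_and_card.1 ht).2
        rw [he', hd'] at this
        obtain rfl : e = n := by omega
        simp
      · obtain ⟨f, hf⟩ := hcb.exists_adj_iff
        have hge := le_numFourCycles (G := G) (m := n) fun u v huv => by
          have h1 := card_edgeSet_deleteOpposite_of_adj_iff hf huv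
          have h2 := hn u v huv
          omega
        rw [he'] at hge
        have : (e : ℚ) * e ≤ 4 * G.numFourCycles + e * n := by exact_mod_cast hge
        linarith
  · have hc := hodd.not_colorable_two
    have hclq : (G.cliqueFinset 4).card = 0 := by
      rwa [Finset.card_eq_zero, cliqueFinset_eq_empty_iff]
    have hn := hG.card_le_card_edgeSet_deleteOpposite hc
    have hle := numFourCycles_le hn
    rw [he', hd', hclq] at hle
    have hleQ : 4 * (G.numFourCycles : ℚ) + e * d ≤ e * e := by exact_mod_cast hle
    refine ⟨by linarith, fun heq => ?_, fun hu => ?_⟩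
    · refine hodd.hasUniqueCycleOdd hG ?_
      by_contra hne
      have hlt := lt_of_le_of_ne (hG.card_le_card_edgeSet hc) (Ne.symm hne)
      have hcard : ∀ u v, G.Adj u v →
          Nat.card (G.deleteOpposite u v).edgeSet = Nat.card V := fun u v huv => by
        refine card_deleteOpposite_of_numFourCycles_ge hn ?_ huv
        rw [he', hd', hclq]
        have : (e : ℚ) * e ≤ 4 * G.numFourCycles + e * d := by linarith
        exact_mod_cast this
      exact hc <| colorable_two_of_not_isSquare_deleteOpposite hG
        (fun u v huv => exists_isSquare_of_card_lt (hcard u v huv ▸ hlt))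
        (not_isSquare_deleteOpposite hG hc hcard)
    · rw [numFourCycles_eq_zero fun _ _ _ _ => hu.not_isSquare]
      have := hu.card_edgeSet hG
      rw [he', hd'] at this
      simp [this]
  · obtain ⟨φ⟩ := not_cliqueFree_iff_top_isContained 4 |>.1 hK
    have hadj : ∀ i j, i ≠ j → G.Adj (φ i) (φ j) := fun i j h => φ.toHom.map_adj h
    have hc : ¬ G.Colorable 2 := triangle_not_colorable_two
      (hadj 0 1 (by decide)) (hadj 1 2 (by decide)) (hadj 0 2 (by decide))
    have hn := hG.card_le_card_edgeSet_deleteOpposite hc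
    have hlt : 4 * G.numFourCycles + e * d < e * e + 6 * (G.cliqueFinset 4).card := by
      by_contra! hge
      rw [← he', ← hd'] at hge
      have hcard : ∀ u v, G.Adj u v →
          Nat.card (G.deleteOpposite u v).edgeSet = Nat.card V := fun u v huv =>
        card_deleteOpposite_of_numFourCycles_ge hn hge huv
      -- In a `K_4` on `0, 1, 2, 3`, every side of the square `0 2 1 3` meets the edge `01`, so all
      -- four survive its deletion.
      refine not_isSquare_deleteOpposite hG hc hcard (φ 0) (φ 1) (hadj 0 1 (by decide))
        (φ 0) (φ 2) (φ 1) (φ 3) ⟨?_, ?_, ?_, ?_, ?_, ?_⟩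
      · exact (hadj 0 2 (by decide)).deleteOpposite_left
      · exact (hadj 1 2 (by decide)).deleteOpposite_right.symm
      · exact (hadj 1 3 (by decide)).deleteOpposite_right
      · exact (hadj 0 3 (by decide)).deleteOpposite_left.symm
      · exact (hadj 0 1 (by decide)).ne
      · exact (hadj 2 3 (by decide)).ne
    have hltQ : 4 * (G.numFourCycles : ℚ) + e * d < e * e + 6 * (G.cliqueFinset 4).card := by
      exact_mod_cast hlt
    linarith
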